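/- Let $r\ge 1$ be an integer, $\varphi(x)=\sqrt{1-x^2}$, and $C^0=C^0([-1,1])$ the space of continuous real functions on $[-1,1]$ with the uniform norm $\|\cdot\|_\infty$. Let $$W^r=\left\{f\in C^0:\ f^{(r-1)}\in AC((-1,1)),\ \|f^{(r)}\varphi^r\|_\infty<\infty\right\},\qquad \|f\|_{W^r}=\|f\|_\infty+\|f^{(r)}\varphi^r\|_\infty ,$$ where $AC((-1,1))$ is the set of functions that are absolutely continuous on every compact subinterval of $(-1,1)$, and $\|f^{(r)}\varphi^r\|_\infty$ is the essential supremum over $(-1,1)$ (the derivative $f^{(r)}$ exists almost everywhere). Let $k_1,k_2:[-1,1]^2\to\mathbb R$ be such that $x\mapsto k_i(x,y)$ is integrable on $[-1,1]$ for every $y\in[-1,1]$, $i=1,2$, and let $h:[-1,1]\times\mathbb R\to\mathbb R$ be continuous. For $f\in C^0$ put $$(K^if)(y)=\int_{-1}^1k_i(x,y)f(x)\,dx,\qquad (Hf)(x)=h(x,f(x)),\qquad \mathcal K f=K^1f+K^2Hf .$$ Suppose that $k_i(x,\cdot)\in W^r$ for every $x\in[-1,1]$ and $$\sup_{x\in[-1,1]}\|k_i(x,\cdot)\|_{W^r}<\infty,\qquad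 i=1,2 .$$ Then $\mathcal K f\in W^r$ for every $f\in C^0$. Consequently, if also $g\in W^r$, then every solution $f^*\in C^0$ of the equation $$f^*(y)=(\mathcal K f^*)(y)+g(y),\qquad y\in[-1,1],$$ belongs to $W^r$. -/

import Mathlib

noncomputable section

namespace Hammerstein

/- Functions on `[-1,1]` are represented by functions on `ℝ` of which only the values on
`[-1,1]` are used (derivatives are taken at interior points only). -/

/-- The weight `φ(x) = √(1 - x²)`. -/
def phi (x : ℝ) : ℝ := Real.sqrt (1 - x ^ 2)

/-- `AC((-1,1))`: absolute continuity on every compact subinterval of `(-1,1)`. -/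
def ACOpen (u : ℝ → ℝ) : Prop :=
  ∀ a b : ℝ, -1 < a → a ≤ b → b < 1 → AbsolutelyContinuousOnInterval u a b

/-- The uniform norm on `[-1,1]`. -/
def supNorm (f : ℝ → ℝ) : ENNReal := ⨆ x ∈ Set.Icc (-1 : ℝ) 1, ENNReal.ofReal |f x|

/-- The seminorm `‖f^{(r)} φ^r‖_∞`, an essential supremum over `(-1,1)` since `f^{(r)}` is in
general defined only almost everywhere. -/
def weightedSeminorm (r : ℕ) (f : ℝ → ℝ) : ENNReal :=
  MeasureTheory.eLpNorm (fun x => iteratedDeriv r f x * phi x ^ r) ⊤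
    (MeasureTheory.volume.restrict (Set.Ioo (-1 : ℝ) 1))

/-- Membership in the Sobolev-type space `W^r` of order `r ≥ 1`. -/
structure MemW (r : ℕ) (f : ℝ → ℝ) : Prop where
  continuousOn : ContinuousOn f (Set.Icc (-1) 1)
  contDiffOn : ContDiffOn ℝ ((r - 1 : ℕ) : WithTop ℕ∞) f (Set.Ioo (-1) 1)
  absCont : ACOpen (iteratedDeriv (r - 1) f)
  seminorm_lt_top : weightedSeminorm r f < ⊤

/-- The norm `‖f‖_{W^r} = ‖f‖_∞ + ‖f^{(r)} φ^r‖_∞`, with values in `[0,∞]`. -/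
def normW (r : ℕ) (f : ℝ → ℝ) : ENNReal := supNorm f + weightedSeminorm r f

/-- The Fredholm operator `(K f)(y) = ∫_{-1}^{1} k(x,y) f(x) dx`. -/
def fredholm (k : ℝ → ℝ → ℝ) (f : ℝ → ℝ) (y : ℝ) : ℝ := ∫ x in (-1 : ℝ)..1, k x y * f x

/-- The Nemytskii operator `(H f)(x) = h(x, f(x))`. -/
def nemytskii (h : ℝ → ℝ → ℝ) (f : ℝ → ℝ) (x : ℝ) : ℝ := h x (f x)

/-- The operator `𝒦 = K¹ + K² H`. -/
def opK (k₁ k₂ h : ℝ → ℝ → ℝ) (f : ℝ → ℝ) (y : ℝ) : ℝ :=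
  fredholm k₁ f y + fredholm k₂ (nemytskii h f) y

/-- `f` is a continuous solution of `f = 𝒦 f + g` on `[-1,1]`. -/
structure IsSolution (k₁ k₂ h : ℝ → ℝ → ℝ) (g f : ℝ → ℝ) : Prop where
  continuousOn : ContinuousOn f (Set.Icc (-1) 1)
  eq : ∀ y ∈ Set.Icc (-1 : ℝ) 1, f y = opK k₁ k₂ h f y + g y

end Hammerstein

end

namespace Hammerstein

open MeasureTheory Set Filter Topology

/-! The derivative of order `r` exists only almost everywhere and is awkward to integrate in a
parameter. It is replaced by an equivalent pointwise condition (`memW_succ_iff`): `u^{(r-1)}` is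
Lipschitz on each `[-c,c]` with constant `M φ(c)^{-r}`. An inequality between values survives
integration against a bounded `w`. It remains to differentiate `∫ k(x,y) w(x) dx` under the integral
sign `r - 1` times. The hypotheses bound only `k(x,·)` and its top derivative; interpolation bounds
the intermediate derivatives on `[-c,c]`, uniformly in `x`, which gives the dominating constants.
Since `Hf` is continuous along with `f`, one lemma, `MemW.fredholm`, handles both kernels. -/

theorem phi_pos {x : ℝ} (hx : x ∈ Ioo (-1 : ℝ) 1) : 0 < phi x :=
  Real.sqrt_pos.2 (by nlinarith [hx.1, hx.2])

theorem phi_nonneg (x : ℝ) : 0 ≤ phi x := Real.sqrt_nonneg _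

theorem phi_le_phi {x c : ℝ} (h : |x| ≤ c) : phi c ≤ phi x :=
  Real.sqrt_le_sqrt (by nlinarith [abs_nonneg x, sq_abs x])

theorem continuous_phi : Continuous phi := by
  unfold phi; fun_prop

/-- A weighted local Lipschitz condition on `(-1,1)` with the constant `M φ(c)^{-r}` on
`[-c,c]`. -/
def WeightedLipschitz (r : ℕ) (M : ℝ) (v : ℝ → ℝ) : Prop :=
  ∀ c : ℝ, 0 < c → c < 1 → ∀ a ∈ Icc (-c) c, ∀ b ∈ Icc (-c) c,
    |v b - v a| ≤ M / phi c ^ r * |b - a|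

/-! ### The weighted Lipschitz condition and its equivalence with `W^r` -/

theorem exists_Icc_mem_nhds {y : ℝ} (hy : y ∈ Ioo (-1 : ℝ) 1) :
    ∃ c : ℝ, 0 < c ∧ c < 1 ∧ y ∈ Ioo (-c) c := by
  obtain ⟨c, hc, hc1⟩ := exists_between (abs_lt.2 hy)
  exact ⟨c, (abs_nonneg y).trans_lt hc, hc1, abs_lt.1 hc⟩

theorem WeightedLipschitz.lipschitzOnWith {r : ℕ} {M : ℝ} {v : ℝ → ℝ}
    (h : WeightedLipschitz r M v) {c : ℝ} (hc : 0 < c) (hc1 : c < 1) :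
    LipschitzOnWith (M / phi c ^ r).toNNReal v (Icc (-c) c) :=
  LipschitzOnWith.of_dist_le' fun x hx y hy => by
    rw [Real.dist_eq, Real.dist_eq]; exact h c hc hc1 y hy x hx

theorem WeightedLipschitz.continuousOn {r : ℕ} {M : ℝ} {v : ℝ → ℝ}
    (h : WeightedLipschitz r M v) : ContinuousOn v (Ioo (-1) 1) := fun y hy => by
  obtain ⟨c, hc, hc1, hyc⟩ := exists_Icc_mem_nhds hy
  exact ((h.lipschitzOnWith hc hc1).continuousOn.continuousAt
    (Icc_mem_nhds hyc.1 hyc.2)).continuousWithinAt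

theorem WeightedLipschitz.acOpen {r : ℕ} {M : ℝ} {v : ℝ → ℝ}
    (h : WeightedLipschitz r M v) : ACOpen v := fun a b ha hab hb => by
  obtain ⟨c, hc, hc1⟩ := exists_between
    (max_lt (abs_lt.2 ⟨ha, hab.trans_lt hb⟩) (abs_lt.2 ⟨ha.trans_le hab, hb⟩))
  have hac := abs_le.1 ((le_max_left _ _).trans hc.le)
  have hbc := abs_le.1 ((le_max_right _ _).trans hc.le)
  refine ((h.lipschitzOnWith (((abs_nonneg a).trans (le_max_left _ _)).trans_lt hc) hc1).mono
    ?_).absolutelyContinuousOnInterval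
  rw [uIcc_of_le hab]
  exact Icc_subset_Icc hac.1 hbc.2

/-- For every `c > |y|` the Lipschitz constant on `[-c,c]` bounds the derivative at `y`; letting `c`
decrease to `|y|` recovers the weight at `y` without loss. Where `v` is not differentiable, `deriv`
is `0`. -/
theorem WeightedLipschitz.abs_deriv_mul_le {r : ℕ} {M : ℝ} (hM : 0 ≤ M) {v : ℝ → ℝ}
    (h : WeightedLipschitz r M v) {y : ℝ} (hy : y ∈ Ioo (-1 : ℝ) 1) :
    |deriv v y * phi y ^ r| ≤ M := by
  have key : ∀ c ∈ Ioo |y| 1, |deriv v y| * phi c ^ r ≤ M := fun c hc => by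
    have hc0 : 0 < c := (abs_nonneg y).trans_lt hc.1
    have hyc := abs_lt.1 hc.1
    have hp : 0 < phi c ^ r := pow_pos (phi_pos ⟨by linarith, hc.2⟩) r
    have := norm_deriv_le_of_lipschitzOn (Icc_mem_nhds hyc.1 hyc.2)
      (h.lipschitzOnWith hc0 hc.2)
    rw [Real.coe_toNNReal _ (by positivity), Real.norm_eq_abs] at this
    exact (le_div_iff₀ hp).1 this
  have hlim : Tendsto (fun c => |deriv v y| * phi c ^ r) (𝓝[>] |y|)
      (𝓝 (|deriv v y| * phi |y| ^ r)) :=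
    ((continuous_const.mul (continuous_phi.pow r)).tendsto _).mono_left nhdsWithin_le_nhds
  have hphi : phi |y| = phi y := by simp [phi]
  rw [hphi] at hlim
  rw [abs_mul, abs_of_pos (pow_pos (phi_pos hy) r)]
  exact le_of_tendsto hlim (mem_of_superset (Ioo_mem_nhdsGT (abs_lt.2 hy)) key)

theorem WeightedLipschitz.congr {r : ℕ} {M : ℝ} {v w : ℝ → ℝ}
    (h : WeightedLipschitz r M v) (hvw : EqOn w v (Ioo (-1) 1)) : WeightedLipschitz r M w :=
  fun c hc hc1 a ha b hb => by
    have hsub : Icc (-c) c ⊆ Ioo (-1) 1 := Icc_subset_Ioo (by linarith) hc1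
    rw [hvw (hsub ha), hvw (hsub hb)]
    exact h c hc hc1 a ha b hb

theorem WeightedLipschitz.add {r : ℕ} {M N : ℝ} {v w : ℝ → ℝ}
    (hv : WeightedLipschitz r M v) (hw : WeightedLipschitz r N w) :
    WeightedLipschitz r (M + N) (fun x => v x + w x) :=
  fun c hc hc1 a ha b hb => by
    have h1 := hv c hc hc1 a ha b hb
    have h2 := hw c hc hc1 a ha b hb
    rw [add_div, add_mul]
    calc |v b + w b - (v a + w a)| = |(v b - v a) + (w b - w a)| := by ring_nf
      _ ≤ _ := (abs_add_le _ _).trans (add_le_add h1 h2)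

/-- Absolute continuity makes the increment the integral of the derivative, and `φ` is smallest on
`[-c,c]` at the endpoints. -/
theorem MemW.weightedLipschitz {n : ℕ} {u : ℝ → ℝ} (h : MemW (n + 1) u) {M : ℝ} (hM : 0 ≤ M)
    (hle : weightedSeminorm (n + 1) u ≤ ENNReal.ofReal M) :
    WeightedLipschitz (n + 1) M (iteratedDeriv n u) := fun c hc hc1 a ha b hb => by
  have hac := h.absCont (-c) c (by linarith) (by linarith) hc1
  rw [Nat.add_sub_cancel] at hac
  have hsub : uIcc a b ⊆ uIcc (-c) c := by
    rw [uIcc_of_le (show -c ≤ c by linarith)]; exact uIcc_subset_Icc ha hb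
  rw [← (hac.mono hsub).integral_deriv_eq_sub, ← Real.norm_eq_abs]
  have hbound : ∀ᵐ x ∂(volume.restrict (Ioo (-1 : ℝ) 1)),
      |deriv (iteratedDeriv n u) x * phi x ^ (n + 1)| ≤ M := by
    unfold weightedSeminorm at hle
    rw [eLpNorm_exponent_top] at hle
    filter_upwards [ae_le_eLpNormEssSup (μ := volume.restrict (Ioo (-1 : ℝ) 1))
      (f := fun x => iteratedDeriv (n + 1) u x * phi x ^ (n + 1))] with x hx
    rw [← iteratedDeriv_succ]
    have := hx.trans hle
    rwa [Real.enorm_eq_ofReal_abs, ENNReal.ofReal_le_ofReal_iff hM] at this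
  rw [ae_restrict_iff' measurableSet_Ioo] at hbound
  refine intervalIntegral.norm_integral_le_of_norm_le_const_ae ?_
  filter_upwards [hbound] with x hx hxab
  have hxc : x ∈ Icc (-c) c := uIcc_subset_Icc ha hb (uIoc_subset_uIcc hxab)
  have h1 := hx ⟨by linarith [hxc.1], by linarith [hxc.2]⟩
  have hpc : 0 < phi c := phi_pos ⟨by linarith, hc1⟩
  rw [Real.norm_eq_abs, le_div_iff₀ (by positivity)]
  rw [abs_mul, abs_of_nonneg (pow_nonneg (phi_nonneg x) _)] at h1
  refine le_trans ?_ h1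
  gcongr
  exact phi_le_phi (abs_le.2 hxc)

theorem memW_succ_iff {n : ℕ} {u : ℝ → ℝ} : MemW (n + 1) u ↔
    ContinuousOn u (Icc (-1) 1) ∧ ContDiffOn ℝ n u (Ioo (-1) 1) ∧
      ∃ M, 0 ≤ M ∧ WeightedLipschitz (n + 1) M (iteratedDeriv n u) := by
  refine ⟨fun h => ⟨h.continuousOn, h.contDiffOn, _, ENNReal.toReal_nonneg,
    h.weightedLipschitz ENNReal.toReal_nonneg (ENNReal.ofReal_toReal h.seminorm_lt_top.ne).ge⟩,
    fun ⟨h1, h2, M, hM, h3⟩ => ⟨h1, h2, h3.acOpen, ?_⟩⟩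
  rw [weightedSeminorm, eLpNorm_exponent_top]
  refine eLpNormEssSup_lt_top_of_ae_bound (C := M) ?_
  filter_upwards [ae_restrict_mem measurableSet_Ioo] with x hx
  rw [iteratedDeriv_succ]
  exact h3.abs_deriv_mul_le hM hx

theorem iteratedDeriv_eqOn_Ioo {n : ℕ} {u v : ℝ → ℝ} (h : EqOn u v (Icc (-1) 1)) :
    EqOn (iteratedDeriv n u) (iteratedDeriv n v) (Ioo (-1) 1) := fun _ hx =>
  Filter.EventuallyEq.iteratedDeriv_eq n
    (h.eventuallyEq_of_mem (Icc_mem_nhds hx.1 hx.2))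

/-- Derivatives at interior points see only values on `[-1,1]`. Needed because the equation for a
solution holds only there. -/
theorem MemW.congr {r : ℕ} (hr : 1 ≤ r) {u v : ℝ → ℝ} (hu : MemW r u)
    (h : EqOn v u (Icc (-1) 1)) : MemW r v := by
  obtain ⟨n, rfl⟩ := Nat.exists_eq_add_of_le' hr
  obtain ⟨h1, h2, M, hM, h3⟩ := memW_succ_iff.1 hu
  exact memW_succ_iff.2 ⟨h1.congr h, h2.congr (h.mono Ioo_subset_Icc_self), M, hM,
    h3.congr (iteratedDeriv_eqOn_Ioo h)⟩

theorem MemW.add {r : ℕ} (hr : 1 ≤ r) {u v : ℝ → ℝ} (hu : MemW r u) (hv : MemW r v) :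
    MemW r (fun x => u x + v x) := by
  obtain ⟨n, rfl⟩ := Nat.exists_eq_add_of_le' hr
  obtain ⟨h1, h2, M, hM, h3⟩ := memW_succ_iff.1 hu
  obtain ⟨k1, k2, N, hN, k3⟩ := memW_succ_iff.1 hv
  refine memW_succ_iff.2 ⟨h1.add k1, h2.add k2, M + N, add_nonneg hM hN,
    (h3.add k3).congr fun x hx => ?_⟩
  have hnhds := isOpen_Ioo.mem_nhds hx
  exact iteratedDeriv_add (h2.contDiffAt hnhds) (k2.contDiffAt hnhds)

/-! ### Uniform bounds for intermediate derivatives -/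

theorem hasDerivAt_iteratedDeriv {n : ℕ} {u : ℝ → ℝ} {s : Set ℝ} (hs : IsOpen s)
    (h : ContDiffOn ℝ n u s) {j : ℕ} (hj : j < n) {y : ℝ} (hy : y ∈ s) :
    HasDerivAt (iteratedDeriv j u) (iteratedDeriv (j + 1) u y) y := by
  rw [iteratedDeriv_succ]
  have := (h.differentiableOn_iteratedDerivWithin (m := j) (by exact_mod_cast hj)
    hs.uniqueDiffOn).congr fun x hx => (iteratedDerivWithin_of_isOpen hs hx).symm
  exact (this.differentiableAt (hs.mem_nhds hy)).hasDerivAt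

/-- Interpolation: a bound on `u` gives a bound on `u^{(j)}` at some point of the interval, with
a constant independent of `u`. -/
theorem exists_abs_iteratedDeriv_le (n : ℕ) (M : ℝ) (j : ℕ) (hj : j ≤ n) :
    ∀ a b : ℝ, a < b → ∃ C : ℝ, ∀ s : Set ℝ, IsOpen s → Icc a b ⊆ s → ∀ u : ℝ → ℝ,
      ContDiffOn ℝ n u s → (∀ y ∈ Icc a b, |u y| ≤ M) →
      ∃ ξ ∈ Icc a b, |iteratedDeriv j u ξ| ≤ C := by
  induction j with
  | zero =>
    intro a b hab
    exact ⟨M, fun s _ _ u _ hu => ⟨a, left_mem_Icc.2 hab.le, by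
      simpa using hu a (left_mem_Icc.2 hab.le)⟩⟩
  | succ j ih =>
    intro a b hab
    -- Points taken from the two outer thirds are at least `ℓ` apart, so the mean value theorem
    -- between them gives a slope of at most `(C₁ + C₂) / ℓ`.
    set ℓ := (b - a) / 3 with hℓ
    have hℓ0 : 0 < ℓ := by rw [hℓ]; linarith
    have hb : b = a + 3 * ℓ := by rw [hℓ]; ring
    obtain ⟨C₁, hC₁⟩ := ih (by omega) a (a + ℓ) (by linarith)
    obtain ⟨C₂, hC₂⟩ := ih (by omega) (a + 2 * ℓ) b (by linarith)
    refine ⟨(C₁ + C₂) / ℓ, fun s hs hsub u hu hM => ?_⟩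
    have hsub₁ : Icc a (a + ℓ) ⊆ Icc a b := Icc_subset_Icc_right (by linarith)
    have hsub₂ : Icc (a + 2 * ℓ) b ⊆ Icc a b := Icc_subset_Icc_left (by linarith)
    obtain ⟨p, hp, hpC⟩ := hC₁ s hs (hsub₁.trans hsub) u hu fun y hy => hM y (hsub₁ hy)
    obtain ⟨q, hq, hqC⟩ := hC₂ s hs (hsub₂.trans hsub) u hu fun y hy => hM y (hsub₂ hy)
    have hpq : p + ℓ ≤ q := by linarith [hp.2, hq.1]
    have hIcc : Icc p q ⊆ Icc a b := Icc_subset_Icc hp.1 hq.2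
    have hd : ∀ y ∈ Icc p q, HasDerivAt (iteratedDeriv j u) (iteratedDeriv (j + 1) u y) y :=
      fun y hy => hasDerivAt_iteratedDeriv hs hu (by omega) (hsub (hIcc hy))
    obtain ⟨ξ, hξ, hξe⟩ := exists_hasDerivAt_eq_slope (iteratedDeriv j u)
      (iteratedDeriv (j + 1) u) (show p < q by linarith)
      (fun y hy => (hd y hy).continuousAt.continuousWithinAt)
      fun y hy => hd y (Ioo_subset_Icc_self hy)
    refine ⟨ξ, hIcc (Ioo_subset_Icc_self hξ), ?_⟩
    rw [hξe, abs_div, abs_of_pos (show 0 < q - p by linarith)]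
    have hnum : |iteratedDeriv j u q - iteratedDeriv j u p| ≤ C₁ + C₂ :=
      (abs_sub _ _).trans (by linarith)
    exact div_le_div₀ ((abs_nonneg _).trans hnum) hnum hℓ0 (by linarith)

/-- A bound on `u` and a Lipschitz bound on `u^{(n)}` control all `u^{(j)}`, `j ≤ n`, uniformly
in `u`. -/
theorem exists_forall_abs_iteratedDeriv_le (n : ℕ) (M L a b : ℝ) (hab : a < b) (k j : ℕ)
    (hj : j + k = n) : ∃ C : ℝ, ∀ s : Set ℝ, IsOpen s → Icc a b ⊆ s → ∀ u : ℝ → ℝ,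
      ContDiffOn ℝ n u s → (∀ y ∈ Icc a b, |u y| ≤ M) →
      (∀ x ∈ Icc a b, ∀ y ∈ Icc a b,
        |iteratedDeriv n u y - iteratedDeriv n u x| ≤ L * |y - x|) →
      ∀ y ∈ Icc a b, |iteratedDeriv j u y| ≤ C := by
  -- Downward induction on the order `j = n - k`: a bound on the next derivative spreads the
  -- one-point bound over the whole interval.
  induction k generalizing j with
  | zero =>
    obtain rfl : j = n := by omega
    obtain ⟨C, hC⟩ := exists_abs_iteratedDeriv_le j M j le_rfl a b hab
    refine ⟨C + |L| * (b - a), fun s hs hsub u hu hM hL y hy => ?_⟩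
    obtain ⟨ξ, hξ, hξC⟩ := hC s hs hsub u hu hM
    have h1 : L * |y - ξ| ≤ |L| * (b - a) :=
      mul_le_mul (le_abs_self L) (abs_sub_le_iff.2 ⟨by linarith [hy.2, hξ.1],
        by linarith [hy.1, hξ.2]⟩) (abs_nonneg _) (abs_nonneg _)
    linarith [hL ξ hξ y hy, abs_sub_abs_le_abs_sub (iteratedDeriv j u y) (iteratedDeriv j u ξ)]
  | succ k ih =>
    obtain ⟨C', hC'⟩ := ih (j + 1) (by omega)
    obtain ⟨C, hC⟩ := exists_abs_iteratedDeriv_le n M j (by omega) a b hab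
    refine ⟨C + |C'| * (b - a), fun s hs hsub u hu hM hL y hy => ?_⟩
    obtain ⟨ξ, hξ, hξC⟩ := hC s hs hsub u hu hM
    have hd : ∀ z ∈ Icc a b, HasDerivAt (iteratedDeriv j u) (iteratedDeriv (j + 1) u z) z :=
      fun z hz => hasDerivAt_iteratedDeriv hs hu (by omega) (hsub hz)
    have h0 := (convex_Icc a b).norm_image_sub_le_of_norm_hasDerivWithin_le
      (fun z hz => (hd z hz).hasDerivWithinAt) (hC' s hs hsub u hu hM hL) hξ hy
    rw [Real.norm_eq_abs, Real.norm_eq_abs] at h0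
    have h1 : C' * |y - ξ| ≤ |C'| * (b - a) :=
      mul_le_mul (le_abs_self C') (abs_sub_le_iff.2 ⟨by linarith [hy.2, hξ.1],
        by linarith [hy.1, hξ.2]⟩) (abs_nonneg _) (abs_nonneg _)
    linarith [abs_sub_abs_le_abs_sub (iteratedDeriv j u y) (iteratedDeriv j u ξ)]

/-! ### Tools for differentiating under the integral sign -/

theorem contDiffOn_of_hasDerivAt_seq {s : Set ℝ} (hs : IsOpen s) (n : ℕ) (G : ℕ → ℝ → ℝ)
    (hd : ∀ j < n, ∀ y ∈ s, HasDerivAt (G j) (G (j + 1) y) y) (hc : ContinuousOn (G n) s) :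
    ContDiffOn ℝ n (G 0) s := by
  induction n generalizing G with
  | zero => exact contDiffOn_zero.2 hc
  | succ n ih =>
    rw [Nat.cast_succ, contDiffOn_succ_iff_deriv_of_isOpen hs]
    refine ⟨fun y hy => (hd 0 (by omega) y hy).differentiableAt.differentiableWithinAt,
      fun h => absurd h (by simp), ?_⟩
    exact (ih (fun j => G (j + 1)) (fun j hj => hd (j + 1) (by omega)) hc).congr
      fun y hy => (hd 0 (by omega) y hy).deriv

theorem iteratedDeriv_eq_of_hasDerivAt_seq {s : Set ℝ} (hs : IsOpen s) (n : ℕ) (G : ℕ → ℝ → ℝ)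
    (hd : ∀ j < n, ∀ y ∈ s, HasDerivAt (G j) (G (j + 1) y) y) (j : ℕ) (hj : j ≤ n) :
    EqOn (iteratedDeriv j (G 0)) (G j) s := by
  induction j with
  | zero => intro y _; simp
  | succ j ih =>
    intro y hy
    rw [iteratedDeriv_succ, ((ih (by omega)).eventuallyEq_of_mem (hs.mem_nhds hy)).deriv_eq]
    exact (hd j (by omega) y hy).deriv

/-- The derivative in `y` is an a.e. limit of difference quotients, each measurable in `x`. The
steps `(b - y) / (m + 2)` keep the shifted point strictly below `b`, even for `m = 0`. -/
theorem aestronglyMeasurable_of_hasDerivAt_Ioo {μ : Measure ℝ} {K K' : ℝ → ℝ → ℝ} {b : ℝ}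
    (hK : ∀ y ∈ Ioo (-b) b, AEStronglyMeasurable (fun x => K x y) μ) {y : ℝ}
    (hy : y ∈ Ioo (-b) b) (hd : ∀ᵐ x ∂μ, HasDerivAt (K x) (K' x y) y) :
    AEStronglyMeasurable (fun x => K' x y) μ := by
  have hpos : ∀ m : ℕ, 0 < (b - y) / (m + 2) := fun m =>
    div_pos (by linarith [hy.2]) (by positivity)
  have ht0 : Tendsto (fun m : ℕ => (b - y) / ((m : ℝ) + 2)) atTop (𝓝[>] 0) := by
    refine tendsto_nhdsWithin_iff.2 ⟨?_, Eventually.of_forall hpos⟩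
    exact tendsto_const_nhds.div_atTop
      (tendsto_atTop_add_const_right _ _ tendsto_natCast_atTop_atTop)
  refine aestronglyMeasurable_of_tendsto_ae atTop (f := fun (m : ℕ) x =>
    ((b - y) / ((m : ℝ) + 2))⁻¹ • (K x (y + (b - y) / ((m : ℝ) + 2)) - K x y)) (fun m => ?_) ?_
  · refine ((hK (y + (b - y) / ((m : ℝ) + 2)) ⟨by linarith [hpos m, hy.1], ?_⟩).sub (hK y hy)).const_smul (((b - y) / ((m : ℝ) + 2))⁻¹)
    have : (b - y) / ((m : ℝ) + 2) < b - y :=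
      div_lt_self (by linarith [hy.2]) (by linarith [(Nat.cast_nonneg m : (0 : ℝ) ≤ m)])
    linarith
  · filter_upwards [hd] with x hx
    exact hx.tendsto_slope_zero_right.comp ht0

/-! ### Mapping properties of the integral and Nemytskii operators -/

theorem abs_le_of_normW_le {r : ℕ} {u : ℝ → ℝ} {M : ℝ} (hM : 0 ≤ M)
    (h : normW r u ≤ ENNReal.ofReal M) {y : ℝ} (hy : y ∈ Icc (-1 : ℝ) 1) : |u y| ≤ M := by
  refine (ENNReal.ofReal_le_ofReal_iff hM).1 (le_trans ?_ (le_self_add.trans h))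
  exact le_iSup₂ (f := fun x (_ : x ∈ Icc (-1 : ℝ) 1) => ENNReal.ofReal |u x|) y hy

theorem MemW.fredholm {r : ℕ} (hr : 1 ≤ r) {k : ℝ → ℝ → ℝ}
    (hint : ∀ y ∈ Icc (-1 : ℝ) 1, IntervalIntegrable (fun x => k x y) volume (-1) 1)
    (hmem : ∀ x ∈ Icc (-1 : ℝ) 1, MemW r (fun y => k x y))
    (hsup : ⨆ x ∈ Icc (-1 : ℝ) 1, normW r (fun y => k x y) < ⊤)
    {w : ℝ → ℝ} (hw : ContinuousOn w (Icc (-1) 1)) : MemW r (fredholm k w) := by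
  obtain ⟨n, rfl⟩ := Nat.exists_eq_add_of_le' hr
  obtain ⟨M, hM, hkM⟩ : ∃ M : ℝ, 0 ≤ M ∧
      ∀ x ∈ Icc (-1 : ℝ) 1, normW (n + 1) (fun y => k x y) ≤ ENNReal.ofReal M := by
    refine ⟨(⨆ x ∈ Icc (-1 : ℝ) 1, normW (n + 1) (fun y => k x y)).toReal,
      ENNReal.toReal_nonneg, fun x hx => ?_⟩
    rw [ENNReal.ofReal_toReal hsup.ne]
    exact le_iSup₂ (f := fun x (_ : x ∈ Icc (-1 : ℝ) 1) => normW (n + 1) (fun y => k x y)) x hx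
  obtain ⟨B, hB⟩ := isCompact_Icc.exists_bound_of_continuousOn hw
  have hB0 : 0 ≤ B := (norm_nonneg _).trans (hB 0 (by norm_num))
  have hk : ∀ x ∈ Icc (-1 : ℝ) 1, ∀ y ∈ Icc (-1 : ℝ) 1, |k x y| ≤ M := fun x hx y hy =>
    abs_le_of_normW_le hM (hkM x hx) hy
  have hlip : ∀ x ∈ Icc (-1 : ℝ) 1, WeightedLipschitz (n + 1) M (iteratedDeriv n (k x)) :=
    fun x hx => (hmem x hx).weightedLipschitz hM (le_add_self.trans (hkM x hx))
  have hcd : ∀ x ∈ Icc (-1 : ℝ) 1, ContDiffOn ℝ n (k x) (Ioo (-1) 1) :=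
    fun x hx => (hmem x hx).contDiffOn
  have hderiv : ∀ x ∈ Icc (-1 : ℝ) 1, ∀ j < n, ∀ y ∈ Ioo (-1 : ℝ) 1,
      HasDerivAt (iteratedDeriv j (k x)) (iteratedDeriv (j + 1) (k x) y) y :=
    fun x hx j hj y hy => hasDerivAt_iteratedDeriv isOpen_Ioo (hcd x hx) hj hy
  have hioc : uIoc (-1 : ℝ) 1 ⊆ Icc (-1) 1 := by
    rw [uIoc_of_le (by norm_num)]; exact Ioc_subset_Icc_self
  have hbound : ∀ j ≤ n, ∀ c : ℝ, 0 < c → c < 1 → ∃ C : ℝ, 0 ≤ C ∧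
      ∀ x ∈ Icc (-1 : ℝ) 1, ∀ y ∈ Icc (-c) c, |iteratedDeriv j (k x) y| ≤ C := by
    intro j hj c hc hc1
    have hsub : Icc (-c) c ⊆ Ioo (-1) 1 := Icc_subset_Ioo (by linarith) hc1
    obtain ⟨C, hC⟩ := exists_forall_abs_iteratedDeriv_le n M (M / phi c ^ (n + 1)) (-c) c
      (by linarith) (n - j) j (by omega)
    have hC' : ∀ x ∈ Icc (-1 : ℝ) 1, ∀ y ∈ Icc (-c) c, |iteratedDeriv j (k x) y| ≤ C :=
      fun x hx => hC _ isOpen_Ioo hsub _ (hcd x hx)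
        (fun y hy => hk x hx y (Ioo_subset_Icc_self (hsub hy))) (hlip x hx c hc hc1)
    exact ⟨C, (abs_nonneg _).trans (hC' 0 (by norm_num) 0 ⟨by linarith, hc.le⟩), hC'⟩
  have hwm : AEStronglyMeasurable w (volume.restrict (uIoc (-1 : ℝ) 1)) :=
    (hw.mono hioc).aestronglyMeasurable measurableSet_uIoc
  have hmeas : ∀ j ≤ n, ∀ y ∈ Ioo (-1 : ℝ) 1, AEStronglyMeasurable
      (fun x => iteratedDeriv j (k x) y) (volume.restrict (uIoc (-1 : ℝ) 1)) := by
    intro j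
    induction j with
    | zero =>
      intro _ y hy
      simpa using (hint y (Ioo_subset_Icc_self hy)).def'.aestronglyMeasurable
    | succ j ih =>
      intro hj y hy
      refine aestronglyMeasurable_of_hasDerivAt_Ioo (K := fun x => iteratedDeriv j (k x))
        (K' := fun x => iteratedDeriv (j + 1) (k x)) (ih (by omega)) hy ?_
      filter_upwards [ae_restrict_mem measurableSet_uIoc] with x hx
      exact hderiv x (hioc hx) j (by omega) y hy
  have hinteg : ∀ j ≤ n, ∀ y ∈ Ioo (-1 : ℝ) 1,
      IntervalIntegrable (fun x => iteratedDeriv j (k x) y * w x) volume (-1) 1 := by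
    intro j hj y hy
    obtain ⟨c, hc, hc1, hyc⟩ := exists_Icc_mem_nhds hy
    obtain ⟨C, hC0, hC⟩ := hbound j hj c hc hc1
    refine (intervalIntegrable_const (c := C * B)).mono_fun ((hmeas j hj y hy).mul hwm) ?_
    filter_upwards [ae_restrict_mem measurableSet_uIoc] with x hx
    rw [norm_mul, Real.norm_of_nonneg (mul_nonneg hC0 hB0)]
    exact mul_le_mul (hC x (hioc hx) y (Ioo_subset_Icc_self hyc)) (hB x (hioc hx))
      (norm_nonneg _) hC0
  let G : ℕ → ℝ → ℝ := fun j y => ∫ x in (-1 : ℝ)..1, iteratedDeriv j (k x) y * w x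
  have hG0 : G 0 = Hammerstein.fredholm k w := by
    funext y; simp only [G, iteratedDeriv_zero, Hammerstein.fredholm]
  have hGd : ∀ j < n, ∀ y ∈ Ioo (-1 : ℝ) 1, HasDerivAt (G j) (G (j + 1) y) y := by
    intro j hj y hy
    obtain ⟨c, hc, hc1, hyc⟩ := exists_Icc_mem_nhds hy
    obtain ⟨C, hC0, hC⟩ := hbound (j + 1) hj c hc hc1
    have hsub : Icc (-c) c ⊆ Ioo (-1) 1 := Icc_subset_Ioo (by linarith) hc1
    refine (intervalIntegral.hasDerivAt_integral_of_dominated_loc_of_deriv_le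
      (F := fun y x => iteratedDeriv j (k x) y * w x)
      (F' := fun y x => iteratedDeriv (j + 1) (k x) y * w x) (bound := fun _ => C * B)
      (Icc_mem_nhds hyc.1 hyc.2) ?_ (hinteg j hj.le y hy)
      ((hmeas (j + 1) hj y hy).mul hwm) ?_ intervalIntegrable_const ?_).2
    · filter_upwards [isOpen_Ioo.mem_nhds hy] with z hz
      exact (hmeas j hj.le z hz).mul hwm
    · refine Eventually.of_forall fun x hx z hz => ?_
      rw [norm_mul]
      exact mul_le_mul (hC x (hioc hx) z hz) (hB x (hioc hx)) (norm_nonneg _) hC0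
    · exact Eventually.of_forall fun x hx z hz =>
        (hderiv x (hioc hx) j hj z (hsub hz)).mul_const _
  -- The factor `2` is the length of `[-1,1]`. This bound also supplies the continuity of `G n`.
  have hGlip : WeightedLipschitz (n + 1) (2 * M * B) (G n) := by
    intro c hc hc1 a ha b hb
    have hsub : Icc (-c) c ⊆ Ioo (-1) 1 := Icc_subset_Ioo (by linarith) hc1
    simp only [G]
    rw [← intervalIntegral.integral_sub (hinteg n le_rfl b (hsub hb))
      (hinteg n le_rfl a (hsub ha)), ← Real.norm_eq_abs]
    have hpc : 0 < phi c := phi_pos ⟨by linarith, hc1⟩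
    refine (intervalIntegral.norm_integral_le_of_norm_le_const
      (C := M / phi c ^ (n + 1) * |b - a| * B) fun x hx => ?_).trans_eq ?_
    · rw [← sub_mul, norm_mul]
      exact mul_le_mul (hlip x (hioc hx) c hc hc1 a ha b hb) (hB x (hioc hx)) (norm_nonneg _)
        (by positivity)
    · norm_num
      ring
  have hGderiv := iteratedDeriv_eq_of_hasDerivAt_seq isOpen_Ioo n G hGd n le_rfl
  have hGcd := contDiffOn_of_hasDerivAt_seq isOpen_Ioo n G hGd hGlip.continuousOn
  rw [hG0] at hGderiv hGcd
  refine memW_succ_iff.2 ⟨fun y hy => ?_, hGcd, 2 * M * B, by positivity, hGlip.congr hGderiv⟩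
  -- Continuity up to `±1` uses the uniform bound on `k` itself, as the derivative bounds are only
  -- local in `(-1,1)`.
  refine intervalIntegral.continuousWithinAt_of_dominated_interval (bound := fun _ => M * B)
    ?_ ?_ intervalIntegrable_const ?_
  · filter_upwards [self_mem_nhdsWithin] with z hz
    exact (hint z hz).def'.aestronglyMeasurable.mul hwm
  · filter_upwards [self_mem_nhdsWithin] with z hz
    refine Eventually.of_forall fun x hx => ?_
    rw [norm_mul]
    exact mul_le_mul (hk x (hioc hx) z hz) (hB x (hioc hx)) (norm_nonneg _) hM
  · exact Eventually.of_forall fun x hx =>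
      ((hmem x (hioc hx)).continuousOn y hy).mul continuousWithinAt_const

theorem continuousOn_nemytskii {h : ℝ → ℝ → ℝ}
    (hh : ContinuousOn (fun p : ℝ × ℝ => h p.1 p.2) (Icc (-1) 1 ×ˢ univ)) {f : ℝ → ℝ}
    (hf : ContinuousOn f (Icc (-1) 1)) : ContinuousOn (nemytskii h f) (Icc (-1) 1) :=
  hh.comp (continuousOn_id.prodMk hf) fun _ hx => ⟨hx, mem_univ _⟩

end Hammerstein

theorem mainTheorem4 (r : ℕ) (hr : 1 ≤ r) (k₁ k₂ h : ℝ → ℝ → ℝ)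
    (hk₁int : ∀ y ∈ Set.Icc (-1 : ℝ) 1,
      IntervalIntegrable (fun x => k₁ x y) MeasureTheory.volume (-1) 1)
    (hk₂int : ∀ y ∈ Set.Icc (-1 : ℝ) 1,
      IntervalIntegrable (fun x => k₂ x y) MeasureTheory.volume (-1) 1)
    (hh : ContinuousOn (fun p : ℝ × ℝ => h p.1 p.2) (Set.Icc (-1) 1 ×ˢ Set.univ))
    (hk₁mem : ∀ x ∈ Set.Icc (-1 : ℝ) 1, Hammerstein.MemW r (fun y => k₁ x y))
    (hk₂mem : ∀ x ∈ Set.Icc (-1 : ℝ) 1, Hammerstein.MemW r (fun y => k₂ x y))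
    (hk₁sup : ⨆ x ∈ Set.Icc (-1 : ℝ) 1, Hammerstein.normW r (fun y => k₁ x y) < ⊤)
    (hk₂sup : ⨆ x ∈ Set.Icc (-1 : ℝ) 1, Hammerstein.normW r (fun y => k₂ x y) < ⊤) :
    (∀ f : ℝ → ℝ, ContinuousOn f (Set.Icc (-1) 1) →
      Hammerstein.MemW r (Hammerstein.opK k₁ k₂ h f)) ∧
    (∀ g : ℝ → ℝ, Hammerstein.MemW r g → ∀ f : ℝ → ℝ,
      Hammerstein.IsSolution k₁ k₂ h g f → Hammerstein.MemW r f) := by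
  have hK : ∀ f : ℝ → ℝ, ContinuousOn f (Set.Icc (-1) 1) →
      Hammerstein.MemW r (Hammerstein.opK k₁ k₂ h f) := fun f hf =>
    (Hammerstein.MemW.fredholm hr hk₁int hk₁mem hk₁sup hf).add hr
      (Hammerstein.MemW.fredholm hr hk₂int hk₂mem hk₂sup
        (Hammerstein.continuousOn_nemytskii hh hf))
  exact ⟨hK, fun g hg f hf => ((hK f hf.continuousOn).add hr hg).congr hr hf.eq⟩
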